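/- Let $\mathcal G=(\mathcal N,\mathcal E)$, $\mathcal N=\{1,\dots,n\}$, be a strongly connected directed graph without self-loops, and let $d_i^+$ be the number of out-neighbors of node $i$. At each iteration $k=0,1,2,\dots$ an arbitrary set $A^k\subseteq\mathcal N$ of nodes wakes up, and $\mathcal E^k\subseteq\mathcal E$ is the set of links that transmit successfully at iteration $k$; if $(i,j)\in\mathcal E^k$ then $i\in A^k$. Put $\mathcal G^k=(\mathcal N,\mathcal E^k)$. The Robust Asynchronous Push-Sum algorithm starts from arbitrary initial values $x_i^0\in\mathbb R$, $y_i^0=1$, $\sigma_i^{x,0}=\sigma_i^{y,0}=0$ for all $i$, and $\rho_{ij}^{x,0}=\rho_{ij}^{y,0}=0$ for all $(j,i)\in\mathcal E$. At iteration $k$, the $x$-variables are updated as follows. (i) If $i\in A^k$, then $\sigma_i^{x,k+1}=\sigma_i^{x,k}+\frac{x_i^k}{d_i^++1}$ and $\hat x_i^{k}=\frac{x_i^k}{d_i^++1}$; otherwise $\sigma_i^{x,k+1}=\sigma_i^{x,k}$ and $\hat x_i^k=x_i^k$. (ii) If $(j,i)\in\mathcal E^k$, then $\rho_{ij}^{x,k+1}=\sigma_j^{x,k+1}$;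 otherwise $\rho_{ij}^{x,k+1}=\rho_{ij}^{x,k}$. (iii) $x_i^{k+1}=\hat x_i^k+\sum_{j:(j,i)\in\mathcal E^k}\bigl(\rho_{ij}^{x,k+1}-\rho_{ij}^{x,k}\bigr)$. The variables $y_i^k,\sigma_i^{y,k},\rho_{ij}^{y,k}$ are updated in the same way, with the same sets $A^k$ and $\mathcal E^k$. Let $b_1,b_2,\dots$ be positive integers, $\mu_k=\sum_{j=1}^k b_j$ for $k\ge 0$ (so $\mu_0=0$), and $\lambda_k=\sum_{j=(k-1)n+1}^{kn}b_j=\mu_{kn}-\mu_{(k-1)n}$ for $k\ge1$. **Theorem.** Suppose that $\bigcup_{t=\mu_k}^{\mu_{k+1}-1}\mathcal E^t=\mathcal E$ for all $k\ge0$, and that there are an integer $K\ge1$ and a real $T\ge0$ such that $6\,\lambda_k\ln n\le\ln(k+T)$ for all $k\ge K$ (for $n\ge2$, this says $\lambda_k\le\frac{\ln(k+T)}{6\ln n}$). Then $y_i^k>0$ for all $i\in\mathcal N$ and $k\ge0$, and the ratios $z_i^k=x_i^k/y_i^k$ satisfy $$\lim_{k\to\infty}z_i^k=\frac1n\sum_{j=1}^n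 x_j^0\qquad\text{for every } i\in\mathcal N.$$ -/

import Mathlib

open Filter Topology

/-- A directed graph is strongly connected if every node can be reached from every node along
directed links. -/
def StronglyConnected {V : Type*} (G : Digraph V) : Prop :=
  ∀ i j : V, Relation.ReflTransGen G.Adj i j

open Classical in
/-- The number of out-neighbors of node `i`. -/
noncomputable def outDegree {V : Type*} [Fintype V] (G : Digraph V) (i : V) : ℕ :=
  (Finset.univ.filter fun j => G.Adj i j).card

/-- The variables that the nodes keep for one of the two masses (the `x`-mass or the `y`-mass). -/
structure MassState (V : Type*) where
  /-- `val i` is the mass held by node `i` (`x_i` or `y_i`). -/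
  val : V → ℝ
  /-- `sent i` is the running-sum counter `σ_i` of node `i`. -/
  sent : V → ℝ
  /-- `rcvd i j` is the counter `ρ_ij`: the last value of `σ_j` that `i` has received from `j`. It
  is meaningful only if `(j, i)` is a link, and stays `0` otherwise. -/
  rcvd : V → V → ℝ

/-- Initial state: masses `v`, all counters zero. -/
def MassState.init {V : Type*} (v : V → ℝ) : MassState V where
  val := v
  sent := fun _ => 0
  rcvd := fun _ _ => 0

section Step

variable {V : Type*} [Fintype V] (G : Digraph V) (A : Set V) (H : Digraph V) (s : MassState V)

open Classical in
/-- The new counters `σ_i` when the nodes in `A` wake up. -/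
noncomputable def newSent (i : V) : ℝ :=
  if i ∈ A then s.sent i + s.val i / ((outDegree G i : ℝ) + 1) else s.sent i

open Classical in
/-- The new counters `ρ_ij` when the nodes in `A` wake up and the links of `H` deliver. -/
noncomputable def newRcvd (i j : V) : ℝ :=
  if H.Adj j i then newSent G A s j else s.rcvd i j

open Classical in
/-- The new masses: a node that wakes up keeps the fraction `1 / (d_i⁺ + 1)` of its mass, and then
every node adds, for each in-neighbor it has just heard from, the increase of its counter. -/
noncomputable def newVal (i : V) : ℝ :=
  (if i ∈ A then s.val i / ((outDegree G i : ℝ) + 1) else s.val i) +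
    ∑ j ∈ Finset.univ.filter (fun j => H.Adj j i), (newRcvd G A H s i j - s.rcvd i j)

/-- One iteration, for one of the two masses: `A` is the set of nodes that wake up and the links of
`H` are those that transmit successfully. -/
noncomputable def pushSumStep : MassState V where
  val := newVal G A H s
  sent := newSent G A s
  rcvd := newRcvd G A H s

end Step

/-- The state, for one of the two masses started from `v`, after `k` iterations of Robust
Asynchronous Push-Sum over `G`; at iteration `k` the nodes in `A k` wake up and the links of `H k`
transmit successfully. -/
noncomputable def pushSumRun {V : Type*} [Fintype V] (G : Digraph V) (A : ℕ → Set V)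
    (H : ℕ → Digraph V) (v : V → ℝ) : ℕ → MassState V
  | 0 => MassState.init v
  | k + 1 => pushSumStep G (A k) (H k) (pushSumRun G A H v k)

/-- `x_i^k`: the `x`-mass starts from the initial values `x0`. -/
noncomputable def xMass {V : Type*} [Fintype V] (G : Digraph V) (A : ℕ → Set V)
    (H : ℕ → Digraph V) (x0 : V → ℝ) (k : ℕ) (i : V) : ℝ :=
  (pushSumRun G A H x0 k).val i

/-- `y_i^k`: the `y`-mass starts from the all-ones vector. -/
noncomputable def yMass {V : Type*} [Fintype V] (G : Digraph V) (A : ℕ → Set V)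
    (H : ℕ → Digraph V) (k : ℕ) (i : V) : ℝ :=
  (pushSumRun G A H (fun _ => 1) k).val i

/-- `μ_k = b_1 + ⋯ + b_k`, the first time of block number `k + 1`. -/
def blockStart (b : ℕ → ℕ) (k : ℕ) : ℕ := ∑ j ∈ Finset.Icc 1 k, b j

/-- `λ_k = b_{(k-1)n+1} + ⋯ + b_{kn}` for `k ≥ 1`, and `λ_0 = 0`. -/
def blockGroupLength (n : ℕ) (b : ℕ → ℕ) (k : ℕ) : ℕ :=
  ∑ j ∈ Finset.Icc ((k - 1) * n + 1) (k * n), b j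

/-! The argument rests on linearity and positivity. The run started from `x - q` is the `x`-run
minus `q` times the `y`-run (`pushSumRun_add_mul`). If all its masses, in transit included, are
nonnegative at some time, they stay so, and hence `x_i / y_i ≥ q` from then on. It remains to push
`q` up to the average `a`.

Write `N = |V|`. Total mass is conserved, and an iteration shrinks a node's mass at most by the
factor `1 / N`, while a delivering link passes at least that fraction on. By strong connectivity,
after `N` blocks every node holds a definite share of a nonnegative total (`sum_le_mul_val`). Since
`y_i ≤ N`, a fixed fraction `δ` of the average can then be subtracted from the initial values; one
more block restores nonnegativity on the links (`nonneg_sub_average`). So over the `k`-th window of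
`2 N` blocks the gap `a - q` shrinks by the factor `1 - δ_k` (`nonneg_run_window`).

The growth bound on `λ_k` makes `δ_k` at least a constant times `1 / k`, so `∑ δ_k` diverges and the
gap tends to `0`. Negating `x` gives the upper bound. -/

/-- All masses are nonnegative, both at the nodes and in transit on the links of `G`. -/
def MassState.Nonneg {V : Type*} (G : Digraph V) (s : MassState V) : Prop :=
  (∀ i, 0 ≤ s.val i) ∧ ∀ i j, G.Adj j i → s.rcvd i j ≤ s.sent j

/-! ### One iteration: positivity, conservation of mass, loss by at most the factor `1 / |V|`. -/

section Invariants

variable {V : Type*} [Fintype V] {G : Digraph V}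

open Classical in
/-- The mass at the nodes plus the mass in transit on the links of `G`. -/
noncomputable def MassState.total (G : Digraph V) (s : MassState V) : ℝ :=
  ∑ i, s.val i + ∑ i, ∑ j ∈ Finset.univ.filter (fun j => G.Adj j i), (s.sent j - s.rcvd i j)

theorem outDegree_add_one_le_card (hloop : ∀ i, ¬ G.Adj i i) (i : V) :
    outDegree G i + 1 ≤ Fintype.card V := by
  classical
  unfold outDegree
  have : (Finset.univ.filter fun j => G.Adj i j) ⊂ Finset.univ := by
    rw [Finset.filter_ssubset]
    exact ⟨i, Finset.mem_univ _, hloop i⟩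
  have := Finset.card_lt_card this
  rw [Finset.card_univ] at this
  exact Nat.succ_le_of_lt (by convert this)

variable {A : Set V} {H : Digraph V} {s : MassState V}

theorem sent_le_newSent {j : V} (h : 0 ≤ s.val j) : s.sent j ≤ newSent G A s j := by
  unfold newSent
  split_ifs
  · have : 0 ≤ s.val j / ((outDegree G j : ℝ) + 1) := by positivity
    linarith
  · rfl

theorem rcvd_le_newRcvd (hs : s.Nonneg G) (hHG : ∀ i j, H.Adj i j → G.Adj i j) (i j : V) :
    s.rcvd i j ≤ newRcvd G A H s i j := by
  unfold newRcvd
  split_ifs with h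
  · exact (hs.2 i j (hHG _ _ h)).trans (sent_le_newSent (hs.1 j))
  · rfl

theorem newRcvd_le_newSent {i j : V} (h : s.rcvd i j ≤ s.sent j) (hj : 0 ≤ s.val j) :
    newRcvd G A H s i j ≤ newSent G A s j := by
  unfold newRcvd
  split_ifs
  · rfl
  · exact h.trans (sent_le_newSent hj)

open Classical in
theorem val_div_card_le_kept (hloop : ∀ i, ¬ G.Adj i i) {i : V} (h : 0 ≤ s.val i) :
    s.val i / Fintype.card V ≤
      if i ∈ A then s.val i / ((outDegree G i : ℝ) + 1) else s.val i := by
  have hd : (outDegree G i : ℝ) + 1 ≤ Fintype.card V := by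
    exact_mod_cast outDegree_add_one_le_card hloop i
  have h1 : s.val i / Fintype.card V ≤ s.val i / ((outDegree G i : ℝ) + 1) := by gcongr
  split_ifs
  · exact h1
  · refine h1.trans (div_le_self h ?_)
    have : (0 : ℝ) ≤ outDegree G i := by positivity
    linarith

theorem val_div_card_le_newVal (hs : s.Nonneg G) (hloop : ∀ i, ¬ G.Adj i i)
    (hHG : ∀ i j, H.Adj i j → G.Adj i j) (i : V) :
    s.val i / Fintype.card V ≤ newVal G A H s i := by
  classical
  refine (val_div_card_le_kept (A := A) hloop (hs.1 i)).trans ?_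
  unfold newVal
  refine le_add_of_nonneg_right (Finset.sum_nonneg fun j _ => ?_)
  exact sub_nonneg.2 (rcvd_le_newRcvd hs hHG i j)

theorem newSent_sub_rcvd_le_newVal (hs : s.Nonneg G) (hloop : ∀ i, ¬ G.Adj i i)
    (hHG : ∀ i j, H.Adj i j → G.Adj i j) {i j : V} (h : H.Adj j i) :
    newSent G A s j - s.rcvd i j ≤ newVal G A H s i := by
  classical
  unfold newVal
  have h0 : 0 ≤ s.val i / Fintype.card V := div_nonneg (hs.1 i) (by positivity)
  have h1 := h0.trans (val_div_card_le_kept (A := A) hloop (hs.1 i))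
  refine le_trans ?_ (le_add_of_nonneg_left h1)
  have h2 : newSent G A s j - s.rcvd i j = newRcvd G A H s i j - s.rcvd i j := by
    simp [newRcvd, h]
  rw [h2]
  exact Finset.single_le_sum (f := fun j => newRcvd G A H s i j - s.rcvd i j)
    (fun j _ => sub_nonneg.2 (rcvd_le_newRcvd hs hHG i j)) (by simp [h])

theorem val_div_card_le_newVal_of_adj (hs : s.Nonneg G) (hloop : ∀ i, ¬ G.Adj i i)
    (hHG : ∀ i j, H.Adj i j → G.Adj i j) (hHA : ∀ i j, H.Adj i j → i ∈ A)
    {i j : V} (h : H.Adj j i) : s.val j / Fintype.card V ≤ newVal G A H s i := by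
  classical
  refine le_trans ?_ (newSent_sub_rcvd_le_newVal (A := A) hs hloop hHG h)
  have h1 := val_div_card_le_kept (A := A) hloop (hs.1 j)
  have h2 := hs.2 i j (hHG _ _ h)
  unfold newSent
  rw [if_pos (hHA _ _ h)] at h1 ⊢
  linarith

theorem MassState.Nonneg.step (hs : s.Nonneg G) (hloop : ∀ i, ¬ G.Adj i i)
    (hHG : ∀ i j, H.Adj i j → G.Adj i j) : (pushSumStep G A H s).Nonneg G :=
  ⟨fun i => (div_nonneg (hs.1 i) (by positivity)).trans (val_div_card_le_newVal hs hloop hHG i),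
    fun i j h => newRcvd_le_newSent (hs.2 i j h) (hs.1 j)⟩

/-- A waking node splits its mass into `d⁺ + 1` equal shares: it keeps one, and the growth of `σ`
puts one in transit on each out-link. A delivery only moves mass from a link to its head. -/
theorem total_pushSumStep (hHG : ∀ i j, H.Adj i j → G.Adj i j) :
    (pushSumStep G A H s).total G = s.total G := by
  classical
  have hrcvd : ∀ i, ∑ j ∈ Finset.univ.filter (fun j => H.Adj j i),
      (newRcvd G A H s i j - s.rcvd i j) =
      ∑ j ∈ Finset.univ.filter (fun j => G.Adj j i), (newRcvd G A H s i j - s.rcvd i j) := by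
    intro i
    refine Finset.sum_subset (fun j hj => ?_) (fun j _ hj => ?_)
    · simp only [Finset.mem_filter, Finset.mem_univ, true_and] at hj ⊢
      exact hHG _ _ hj
    · simp only [Finset.mem_filter, Finset.mem_univ, true_and] at hj
      simp [newRcvd, hj]
  have hswap : ∑ i, ∑ j ∈ Finset.univ.filter (fun j => G.Adj j i),
      (newSent G A s j - s.sent j) = ∑ j, (outDegree G j : ℝ) * (newSent G A s j - s.sent j) := by
    simp_rw [Finset.sum_filter]
    rw [Finset.sum_comm]
    refine Finset.sum_congr rfl fun j _ => ?_
    rw [← Finset.sum_filter, Finset.sum_const, nsmul_eq_mul]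
    congr! 2
  have hkept : ∀ j, (if j ∈ A then s.val j / ((outDegree G j : ℝ) + 1) else s.val j) +
      (outDegree G j : ℝ) * (newSent G A s j - s.sent j) = s.val j := by
    intro j
    unfold newSent
    split_ifs
    · field_simp
      ring
    · ring
  have hval : ∑ j, s.val j = ∑ j, ((if j ∈ A then s.val j / ((outDegree G j : ℝ) + 1)
      else s.val j) + (outDegree G j : ℝ) * (newSent G A s j - s.sent j)) :=
    Finset.sum_congr rfl fun j _ => (hkept j).symm
  unfold MassState.total pushSumStep
  simp only [newVal, hrcvd]
  rw [hval]
  rw [Finset.sum_add_distrib, Finset.sum_add_distrib, ← hswap, add_assoc, add_assoc]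
  congr 1
  rw [← Finset.sum_add_distrib, ← Finset.sum_add_distrib]
  refine Finset.sum_congr rfl fun i _ => ?_
  rw [← Finset.sum_add_distrib, ← Finset.sum_add_distrib]
  refine Finset.sum_congr rfl fun j _ => ?_
  ring

end Invariants

theorem nonneg_init {V : Type*} {G : Digraph V} {v : V → ℝ} (hv : ∀ i, 0 ≤ v i) :
    (MassState.init v).Nonneg G :=
  ⟨hv, fun _ _ _ => le_rfl⟩

/-! ### Whole runs: linearity, bounds on the masses, expanding sets of nodes. -/

section Run

variable {V : Type*} [Fintype V] {G : Digraph V} {A : ℕ → Set V} {H : ℕ → Digraph V}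

theorem MassState.Nonneg.run_mono (hloop : ∀ i, ¬ G.Adj i i)
    (hHG : ∀ k i j, (H k).Adj i j → G.Adj i j) {v : V → ℝ} {s t : ℕ} (hst : s ≤ t)
    (h : (pushSumRun G A H v s).Nonneg G) : (pushSumRun G A H v t).Nonneg G := by
  induction t, hst using Nat.le_induction with
  | base => exact h
  | succ t _ ih => exact ih.step hloop (hHG t)

theorem total_pushSumRun (hHG : ∀ k i j, (H k).Adj i j → G.Adj i j) (v : V → ℝ) (t : ℕ) :
    (pushSumRun G A H v t).total G = ∑ i, v i := by
  induction t with
  | zero => simp [pushSumRun, MassState.init, MassState.total]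
  | succ t ih => rw [← ih]; exact total_pushSumStep (hHG t)

/-- The run depends linearly on the initial values. -/
theorem pushSumRun_add_mul (v w : V → ℝ) (c : ℝ) (t : ℕ) :
    (∀ i, (pushSumRun G A H (fun i => v i + c * w i) t).val i =
      (pushSumRun G A H v t).val i + c * (pushSumRun G A H w t).val i) ∧
    (∀ i, (pushSumRun G A H (fun i => v i + c * w i) t).sent i =
      (pushSumRun G A H v t).sent i + c * (pushSumRun G A H w t).sent i) ∧
    (∀ i j, (pushSumRun G A H (fun i => v i + c * w i) t).rcvd i j =
      (pushSumRun G A H v t).rcvd i j + c * (pushSumRun G A H w t).rcvd i j) := by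
  classical
  induction t with
  | zero => simp [pushSumRun, MassState.init]
  | succ t ih =>
    obtain ⟨hval, hsent, hrcvd⟩ := ih
    have hsent' : ∀ i, newSent G (A t) (pushSumRun G A H (fun i => v i + c * w i) t) i =
        newSent G (A t) (pushSumRun G A H v t) i +
          c * newSent G (A t) (pushSumRun G A H w t) i := by
      intro i
      unfold newSent
      split_ifs
      · rw [hval, hsent]; ring
      · exact hsent i
    have hrcvd' : ∀ i j,
        newRcvd G (A t) (H t) (pushSumRun G A H (fun i => v i + c * w i) t) i j =
        newRcvd G (A t) (H t) (pushSumRun G A H v t) i j +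
          c * newRcvd G (A t) (H t) (pushSumRun G A H w t) i j := by
      intro i j
      unfold newRcvd
      split_ifs
      · exact hsent' j
      · exact hrcvd i j
    refine ⟨fun i => ?_, hsent', hrcvd'⟩
    simp only [pushSumRun, pushSumStep, newVal, hrcvd', hrcvd, hval]
    rw [mul_add, Finset.mul_sum, add_add_add_comm, ← Finset.sum_add_distrib]
    congr 1
    · split_ifs <;> ring
    · exact Finset.sum_congr rfl fun j _ => by ring

theorem yMass_nonneg (hloop : ∀ i, ¬ G.Adj i i) (hHG : ∀ k i j, (H k).Adj i j → G.Adj i j)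
    (t : ℕ) : (pushSumRun G A H (fun _ => 1) t).Nonneg G :=
  MassState.Nonneg.run_mono hloop hHG (Nat.zero_le t) (nonneg_init fun _ => zero_le_one)

theorem yMass_pos (hloop : ∀ i, ¬ G.Adj i i) (hHG : ∀ k i j, (H k).Adj i j → G.Adj i j)
    (t : ℕ) (i : V) : 0 < yMass G A H t i := by
  have : Nonempty V := ⟨i⟩
  induction t with
  | zero => exact zero_lt_one
  | succ t ih =>
    refine lt_of_lt_of_le (div_pos ih ?_)
      (val_div_card_le_newVal (yMass_nonneg hloop hHG t) hloop (hHG t) i)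
    exact_mod_cast Fintype.card_pos

theorem MassState.Nonneg.val_le_total {s : MassState V} (hs : s.Nonneg G) (i : V) :
    s.val i ≤ s.total G := by
  classical
  refine (Finset.single_le_sum (fun j _ => hs.1 j) (Finset.mem_univ i)).trans
    (le_add_of_nonneg_right ?_)
  refine Finset.sum_nonneg fun i _ => Finset.sum_nonneg fun j hj => ?_
  exact sub_nonneg.2 (hs.2 i j (by simpa using hj))

theorem yMass_le_card (hloop : ∀ i, ¬ G.Adj i i) (hHG : ∀ k i j, (H k).Adj i j → G.Adj i j)
    (t : ℕ) (i : V) : yMass G A H t i ≤ Fintype.card V := by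
  refine ((yMass_nonneg hloop hHG t).val_le_total i).trans ?_
  rw [total_pushSumRun hHG]
  simp

/-- There are `|V|` nodes and at most `|V| ^ 2` links. -/
theorem MassState.total_le {s : MassState V} {D : ℝ} (hD : 0 ≤ D) (hval : ∀ i, s.val i ≤ D)
    (hlink : ∀ i j, G.Adj j i → s.sent j - s.rcvd i j ≤ D) :
    s.total G ≤ ((Fintype.card V : ℝ) + (Fintype.card V : ℝ) ^ 2) * D := by
  classical
  have h1 : ∑ i, s.val i ≤ (Fintype.card V : ℝ) * D := by
    simpa using Finset.sum_le_card_nsmul Finset.univ s.val D fun i _ => hval i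
  have h2 : ∀ i, ∑ j ∈ Finset.univ.filter (fun j => G.Adj j i), (s.sent j - s.rcvd i j) ≤
      (Fintype.card V : ℝ) * D := by
    intro i
    refine (Finset.sum_le_card_nsmul _ _ D fun j hj => hlink i j (by simpa using hj)).trans ?_
    rw [nsmul_eq_mul]
    gcongr
    exact Finset.card_le_univ _
  have h3 := Finset.sum_le_card_nsmul Finset.univ _ _ fun i _ => h2 i
  rw [nsmul_eq_mul, Finset.card_univ] at h3
  unfold MassState.total
  linarith

/-- A nonempty set closed under out-links is everything, so each step either reaches all of `V` or
gains a node. -/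
theorem StronglyConnected.eq_univ_of_expanding (hG : StronglyConnected G) {S : ℕ → Set V}
    (hmono : ∀ l, S l ⊆ S (l + 1)) (hadj : ∀ l i j, i ∈ S l → G.Adj i j → j ∈ S (l + 1))
    (h0 : (S 0).Nonempty) : S (Fintype.card V - 1) = Set.univ := by
  have key : ∀ l, S l = Set.univ ∨ l + 1 ≤ (S l).ncard := by
    intro l
    induction l with
    | zero => exact Or.inr ((Set.ncard_pos (Set.toFinite _)).2 h0)
    | succ l ih =>
      rcases ih with h | h
      · exact Or.inl (Set.univ_subset_iff.1 (h ▸ hmono l))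
      by_cases hclosed : ∀ i j, i ∈ S l → G.Adj i j → j ∈ S l
      · left
        obtain ⟨i, hi⟩ : (S l).Nonempty := (Set.ncard_pos (Set.toFinite _)).1 (by omega)
        refine Set.eq_univ_of_forall fun j => hmono l ?_
        induction hG i j with
        | refl => exact hi
        | tail _ hbc ih => exact hclosed _ _ ih hbc
      · right
        push Not at hclosed
        obtain ⟨i, j, hi, hij, hj⟩ := hclosed
        refine (Nat.succ_le_succ h).trans (Set.ncard_lt_ncard ?_ (Set.toFinite _))
        exact ⟨hmono l, fun hsub => hj (hsub (hadj l i j hi hij))⟩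
  rcases key (Fintype.card V - 1) with h | h
  · exact h
  · obtain ⟨i, -⟩ := h0
    have : 0 < Fintype.card V := Fintype.card_pos_iff.2 ⟨i⟩
    refine Set.eq_of_subset_of_ncard_le (Set.subset_univ _) ?_ (Set.toFinite _)
    rw [Set.ncard_univ, Nat.card_eq_fintype_card]
    omega

end Run

/-! ### Spreading of nonnegative mass over `|V|` blocks. -/

section Spread

variable {V : Type*} [Fintype V] {G : Digraph V} {A : ℕ → Set V} {H : ℕ → Digraph V}
  {b : ℕ → ℕ}

theorem blockStart_mono (b : ℕ → ℕ) : Monotone (blockStart b) := fun _ _ h =>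
  Finset.sum_le_sum_of_subset (Finset.Icc_subset_Icc_right h)

/-- The nodes whose mass at time `t`, scaled up by `|V| ^ t`, is at least `D`. -/
def heavyNodes (G : Digraph V) (A : ℕ → Set V) (H : ℕ → Digraph V) (v : V → ℝ) (D : ℝ) (t : ℕ) :
    Set V :=
  {i | D ≤ (Fintype.card V : ℝ) ^ t * (pushSumRun G A H v t).val i}

theorem card_pow_mul_le_of_div_le {a c : ℝ} {t : ℕ} {i : V} (h : a / Fintype.card V ≤ c) :
    (Fintype.card V : ℝ) ^ t * a ≤ (Fintype.card V : ℝ) ^ (t + 1) * c := by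
  have hc : (0 : ℝ) < Fintype.card V := by exact_mod_cast Fintype.card_pos_iff.2 ⟨i⟩
  rw [div_le_iff₀' hc] at h
  rw [pow_succ, mul_assoc]
  gcongr

/-- The scaling by `|V| ^ t` absorbs the largest possible loss per iteration, so heaviness persists.
-/
theorem heavyNodes_subset (hloop : ∀ i, ¬ G.Adj i i) (hHG : ∀ k i j, (H k).Adj i j → G.Adj i j)
    {v : V → ℝ} {D : ℝ} {s t : ℕ} (hs : (pushSumRun G A H v s).Nonneg G) (hst : s ≤ t) :
    heavyNodes G A H v D s ⊆ heavyNodes G A H v D t := by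
  intro i hi
  induction t, hst using Nat.le_induction with
  | base => exact hi
  | succ t hst ih =>
    exact ih.trans (card_pow_mul_le_of_div_le (i := i)
      (val_div_card_le_newVal (hs.run_mono hloop hHG hst) hloop (hHG t) i))

theorem mem_heavyNodes_of_adj (hloop : ∀ i, ¬ G.Adj i i)
    (hHG : ∀ k i j, (H k).Adj i j → G.Adj i j) (hHA : ∀ k i j, (H k).Adj i j → i ∈ A k)
    {v : V → ℝ} {D : ℝ} {t : ℕ} (ht : (pushSumRun G A H v t).Nonneg G) {i j : V}
    (hi : i ∈ heavyNodes G A H v D t) (hij : (H t).Adj i j) :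
    j ∈ heavyNodes G A H v D (t + 1) :=
  hi.trans (card_pow_mul_le_of_div_le (i := i)
    (val_div_card_le_newVal_of_adj ht hloop (hHG t) (hHA t) hij))

/-- Once some node is heavy, all nodes are heavy `|V| - 1` blocks later. -/
theorem heavyNodes_eq_univ (hG : StronglyConnected G) (hloop : ∀ i, ¬ G.Adj i i)
    (hHG : ∀ k i j, (H k).Adj i j → G.Adj i j) (hHA : ∀ k i j, (H k).Adj i j → i ∈ A k)
    (hblock : ∀ k i j, G.Adj i j ↔
      ∃ t, blockStart b k ≤ t ∧ t < blockStart b (k + 1) ∧ (H t).Adj i j)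
    {v : V → ℝ} {D : ℝ} {m : ℕ} (hs : (pushSumRun G A H v (blockStart b m)).Nonneg G)
    (h0 : (heavyNodes G A H v D (blockStart b m)).Nonempty) :
    heavyNodes G A H v D (blockStart b (m + (Fintype.card V - 1))) = Set.univ := by
  have hnn : ∀ l, (pushSumRun G A H v (blockStart b (m + l))).Nonneg G := fun l =>
    hs.run_mono hloop hHG (blockStart_mono b (Nat.le_add_right m l))
  refine hG.eq_univ_of_expanding (S := fun l => heavyNodes G A H v D (blockStart b (m + l)))
    (fun l => ?_) (fun l i j hi hij => ?_) h0
  · exact heavyNodes_subset hloop hHG (hnn l) (blockStart_mono b (Nat.le_succ _))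
  · obtain ⟨t, ht1, ht2, ht⟩ := (hblock (m + l) i j).1 hij
    have hnt := (hnn l).run_mono hloop hHG ht1
    exact heavyNodes_subset hloop hHG (hnt.run_mono hloop hHG (Nat.le_succ t)) ht2
      (mem_heavyNodes_of_adj hloop hHG hHA hnt (heavyNodes_subset hloop hHG (hnn l) ht1 hi) ht)

/-- Mass in transit has arrived after one block. -/
theorem mem_heavyNodes_of_in_transit (hloop : ∀ i, ¬ G.Adj i i)
    (hHG : ∀ k i j, (H k).Adj i j → G.Adj i j)
    (hblock : ∀ k i j, G.Adj i j ↔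
      ∃ t, blockStart b k ≤ t ∧ t < blockStart b (k + 1) ∧ (H t).Adj i j)
    {v : V → ℝ} {m : ℕ} (hs : (pushSumRun G A H v (blockStart b m)).Nonneg G) {i j : V}
    (hji : G.Adj j i) :
    i ∈ heavyNodes G A H v ((Fintype.card V : ℝ) ^ blockStart b m *
        ((pushSumRun G A H v (blockStart b m)).sent j -
          (pushSumRun G A H v (blockStart b m)).rcvd i j)) (blockStart b (m + 1)) := by
  set s := blockStart b m with hs_def
  set a := (pushSumRun G A H v s).sent j - (pushSumRun G A H v s).rcvd i j with ha
  set D := (Fintype.card V : ℝ) ^ s * a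
  have ha0 : 0 ≤ a := sub_nonneg.2 (hs.2 i j hji)
  have hcard : (1 : ℝ) ≤ Fintype.card V := by exact_mod_cast Fintype.card_pos_iff.2 ⟨i⟩
  have hnn : ∀ t, s ≤ t → (pushSumRun G A H v t).Nonneg G := fun t ht =>
    hs.run_mono hloop hHG ht
  have hdeliver : ∀ t, s ≤ t → (H t).Adj j i →
      a ≤ (pushSumRun G A H v t).sent j - (pushSumRun G A H v t).rcvd i j →
      i ∈ heavyNodes G A H v D (t + 1) := by
    intro t ht hadj hat
    have h1 : a ≤ (pushSumRun G A H v (t + 1)).val i :=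
      (hat.trans (sub_le_sub_right (sent_le_newSent ((hnn t ht).1 j)) _)).trans
        (newSent_sub_rcvd_le_newVal (hnn t ht) hloop (hHG t) hadj)
    exact mul_le_mul (pow_le_pow_right₀ hcard (by omega)) h1 ha0 (by positivity)
  -- Until a delivery, the amount in transit on the link can only grow.
  have key : ∀ t, s ≤ t → i ∈ heavyNodes G A H v D t ∨
      a ≤ (pushSumRun G A H v t).sent j - (pushSumRun G A H v t).rcvd i j := by
    intro t ht
    induction t, ht using Nat.le_induction with
    | base => exact Or.inr le_rfl
    | succ t ht ih =>
      rcases ih with h | h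
      · exact Or.inl (heavyNodes_subset hloop hHG (hnn t ht) (Nat.le_succ t) h)
      by_cases hadj : (H t).Adj j i
      · exact Or.inl (hdeliver t ht hadj h)
      · right
        have h1 : (pushSumRun G A H v (t + 1)).rcvd i j = (pushSumRun G A H v t).rcvd i j := by
          simp [pushSumRun, pushSumStep, newRcvd, hadj]
        have h2 : (pushSumRun G A H v t).sent j ≤ (pushSumRun G A H v (t + 1)).sent j :=
          sent_le_newSent ((hnn t ht).1 j)
        rw [h1]
        linarith
  obtain ⟨t, ht1, ht2, ht⟩ := (hblock m j i).1 hji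
  have ht3 : i ∈ heavyNodes G A H v D (t + 1) := by
    rcases key t ht1 with h | h
    · exact heavyNodes_subset hloop hHG (hnn t ht1) (Nat.le_succ t) h
    · exact hdeliver t ht1 ht h
  exact heavyNodes_subset hloop hHG (hnn _ (by omega)) ht2 ht3

/-- After `|V|` blocks every node holds a definite share of the total mass. -/
theorem sum_le_mul_val (hG : StronglyConnected G) (hloop : ∀ i, ¬ G.Adj i i)
    (hHG : ∀ k i j, (H k).Adj i j → G.Adj i j) (hHA : ∀ k i j, (H k).Adj i j → i ∈ A k)
    (hblock : ∀ k i j, G.Adj i j ↔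
      ∃ t, blockStart b k ≤ t ∧ t < blockStart b (k + 1) ∧ (H t).Adj i j)
    {v : V → ℝ} {m : ℕ} (hs : (pushSumRun G A H v (blockStart b m)).Nonneg G)
    {t : ℕ} (ht : blockStart b (m + Fintype.card V) ≤ t) (i : V) :
    ∑ j, v j ≤ ((Fintype.card V : ℝ) + (Fintype.card V : ℝ) ^ 2) *
      ((Fintype.card V : ℝ) ^ (t - blockStart b m) * (pushSumRun G A H v t).val i) := by
  have hcard : 0 < Fintype.card V := Fintype.card_pos_iff.2 ⟨i⟩
  have hst : blockStart b m ≤ t := (blockStart_mono b (Nat.le_add_right _ _)).trans ht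
  have hnn : ∀ l, (pushSumRun G A H v (blockStart b (m + l))).Nonneg G := fun l =>
    hs.run_mono hloop hHG (blockStart_mono b (Nat.le_add_right m l))
  have hunscale : ∀ a : ℝ, i ∈ heavyNodes G A H v ((Fintype.card V : ℝ) ^ blockStart b m * a) t →
      a ≤ (Fintype.card V : ℝ) ^ (t - blockStart b m) * (pushSumRun G A H v t).val i := by
    intro a h
    have hpow : (Fintype.card V : ℝ) ^ t = (Fintype.card V : ℝ) ^ blockStart b m *
        (Fintype.card V : ℝ) ^ (t - blockStart b m) := by
      rw [← pow_add, Nat.add_sub_cancel' hst]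
    rw [heavyNodes, Set.mem_ofPred_eq, hpow, mul_assoc] at h
    exact le_of_mul_le_mul_left h (by positivity)
  rw [← total_pushSumRun (A := A) hHG v (blockStart b m)]
  refine MassState.total_le ?_ (fun j => hunscale _ ?_) (fun k j hjk => hunscale _ ?_)
  · exact mul_nonneg (by positivity) ((hs.run_mono hloop hHG hst).1 i)
  · have h := heavyNodes_eq_univ hG hloop hHG hHA hblock hs
      ⟨j, le_refl ((Fintype.card V : ℝ) ^ blockStart b m *
        (pushSumRun G A H v (blockStart b m)).val j)⟩
    exact heavyNodes_subset hloop hHG (hnn _)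
      ((blockStart_mono b (by omega)).trans ht) (h.symm ▸ Set.mem_univ i)
  -- Mass in transit needs one block to arrive and `|V| - 1` to spread: hence `|V|` blocks.
  · have h := heavyNodes_eq_univ hG hloop hHG hHA hblock (hnn 1)
      ⟨k, mem_heavyNodes_of_in_transit hloop hHG hblock hs hjk⟩
    exact heavyNodes_subset hloop hHG
      (hs.run_mono hloop hHG (blockStart_mono b (by omega)))
      ((blockStart_mono b (by omega)).trans ht) (h.symm ▸ Set.mem_univ i)

/-- If the masses at the nodes stay nonnegative during a block, then the masses in transit are
nonnegative at its end. -/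
theorem nonneg_of_val_nonneg
    (hblock : ∀ k i j, G.Adj i j ↔
      ∃ t, blockStart b k ≤ t ∧ t < blockStart b (k + 1) ∧ (H t).Adj i j)
    {v : V → ℝ} {m : ℕ}
    (h : ∀ t, blockStart b m ≤ t → t ≤ blockStart b (m + 1) →
      ∀ i, 0 ≤ (pushSumRun G A H v t).val i) :
    (pushSumRun G A H v (blockStart b (m + 1))).Nonneg G := by
  refine ⟨h _ (blockStart_mono b (Nat.le_succ m)) le_rfl, fun i j hji => ?_⟩
  obtain ⟨t₀, ht1, ht2, ht⟩ := (hblock m j i).1 hji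
  -- The delivery at `t₀` makes the two counters equal, whatever their order before.
  have key : ∀ t, t₀ + 1 ≤ t → t ≤ blockStart b (m + 1) →
      (pushSumRun G A H v t).rcvd i j ≤ (pushSumRun G A H v t).sent j := by
    intro t h1
    induction t, h1 using Nat.le_induction with
    | base =>
      intro _
      simp [pushSumRun, pushSumStep, newRcvd, ht]
    | succ t h1 ih =>
      intro h2
      exact newRcvd_le_newSent (ih (by omega)) (h t (by omega) (by omega) j)
  exact key _ ht2 le_rfl

/-- The contraction factor of a window of length `w`. -/
noncomputable def mixingRate (V : Type*) [Fintype V] (w : ℕ) : ℝ :=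
  (((Fintype.card V : ℝ) + (Fintype.card V : ℝ) ^ 2) * (Fintype.card V : ℝ) ^ w)⁻¹

/-- After `|V|` blocks each node holds at least `mixingRate V w * ∑ v`, whereas the subtracted run
is a multiple of `y ≤ |V|`. The subtraction may leave links negative, which the additional block
repairs. -/
theorem nonneg_sub_average (hG : StronglyConnected G) (hloop : ∀ i, ¬ G.Adj i i)
    (hHG : ∀ k i j, (H k).Adj i j → G.Adj i j) (hHA : ∀ k i j, (H k).Adj i j → i ∈ A k)
    (hblock : ∀ k i j, G.Adj i j ↔
      ∃ t, blockStart b k ≤ t ∧ t < blockStart b (k + 1) ∧ (H t).Adj i j)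
    {v : V → ℝ} {m w : ℕ} (hs : (pushSumRun G A H v (blockStart b m)).Nonneg G)
    (hw : blockStart b (m + Fintype.card V + 1) ≤ blockStart b m + w) (hv : 0 ≤ ∑ j, v j) :
    (pushSumRun G A H (fun i => v i - mixingRate V w * ((∑ j, v j) / Fintype.card V))
      (blockStart b (m + Fintype.card V + 1))).Nonneg G := by
  refine nonneg_of_val_nonneg hblock fun t ht1 ht2 i => ?_
  have hcard : (1 : ℝ) ≤ Fintype.card V := by exact_mod_cast Fintype.card_pos_iff.2 ⟨i⟩
  have hst : blockStart b m ≤ t := (blockStart_mono b (Nat.le_add_right _ _)).trans ht1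
  have hlin := (pushSumRun_add_mul (G := G) (A := A) (H := H) v (fun _ => 1)
    (-(mixingRate V w * ((∑ j, v j) / Fintype.card V))) t).1 i
  simp only [mul_one, ← sub_eq_add_neg] at hlin
  rw [hlin, neg_mul, ← sub_eq_add_neg, sub_nonneg]
  have hval := (hs.run_mono hloop hHG hst).1 i
  have hy : (pushSumRun G A H (fun _ => 1) t).val i ≤ Fintype.card V :=
    yMass_le_card hloop hHG t i
  have hsum := sum_le_mul_val hG hloop hHG hHA hblock hs ht1 i
  have hpow : (Fintype.card V : ℝ) ^ (t - blockStart b m) ≤ (Fintype.card V : ℝ) ^ w :=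
    pow_le_pow_right₀ hcard (by omega)
  have hrate : 0 ≤ mixingRate V w := by unfold mixingRate; positivity
  calc mixingRate V w * ((∑ j, v j) / Fintype.card V) * (pushSumRun G A H (fun _ => 1) t).val i
      ≤ mixingRate V w * ((∑ j, v j) / Fintype.card V) * Fintype.card V := by gcongr
    _ = mixingRate V w * ∑ j, v j := by field_simp
    _ ≤ mixingRate V w * (((Fintype.card V : ℝ) + (Fintype.card V : ℝ) ^ 2) *
          ((Fintype.card V : ℝ) ^ w * (pushSumRun G A H v t).val i)) := by
        refine mul_le_mul_of_nonneg_left (hsum.trans ?_) hrate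
        gcongr
    _ = (pushSumRun G A H v t).val i := by
        unfold mixingRate
        field_simp

end Spread

/-! ### Divergence of the sum of contraction factors, and the limit. -/

section Convergence

variable {V : Type*} [Fintype V] {G : Digraph V} {A : ℕ → Set V} {H : ℕ → Digraph V}
  {b : ℕ → ℕ}

theorem mixingRate_nonneg (w : ℕ) : 0 ≤ mixingRate V w := by
  unfold mixingRate; positivity

theorem mixingRate_le_one [Nonempty V] (w : ℕ) : mixingRate V w ≤ 1 := by
  have hcard : (1 : ℝ) ≤ Fintype.card V := by exact_mod_cast Fintype.card_pos
  unfold mixingRate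
  refine inv_le_one_of_one_le₀ (one_le_mul_of_one_le_of_one_le ?_ (one_le_pow₀ hcard))
  nlinarith

/-- The length of the `k`-th window of `2 |V|` blocks. -/
def windowLength (N : ℕ) (b : ℕ → ℕ) (k : ℕ) : ℕ :=
  blockStart b (2 * N * (k + 1)) - blockStart b (2 * N * k)

theorem blockStart_add_blockGroupLength (N : ℕ) (b : ℕ → ℕ) (k : ℕ) :
    blockStart b (N * k) + blockGroupLength N b (k + 1) = blockStart b (N * (k + 1)) := by
  unfold blockStart blockGroupLength
  have hIcc : ∀ q : ℕ, Finset.Icc 1 q = Finset.Ioc 0 q := fun q =>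
    Finset.Icc_add_one_left_eq_Ioc 0 q
  rw [hIcc, hIcc, Finset.Icc_add_one_left_eq_Ioc, Nat.add_sub_cancel, mul_comm k N,
    mul_comm (k + 1) N]
  exact Finset.sum_Ioc_consecutive b (Nat.zero_le _) (Nat.mul_le_mul_left N (Nat.le_succ k))

theorem windowLength_eq (N : ℕ) (b : ℕ → ℕ) (k : ℕ) :
    windowLength N b k =
      blockGroupLength N b (2 * k + 1) + blockGroupLength N b (2 * k + 2) := by
  have h1 := blockStart_add_blockGroupLength N b (2 * k)
  have h2 := blockStart_add_blockGroupLength N b (2 * k + 1)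
  rw [show 2 * k + 1 + 1 = 2 * k + 2 from rfl] at h2
  unfold windowLength
  rw [show 2 * N * (k + 1) = N * (2 * k + 2) by ring, show 2 * N * k = N * (2 * k) by ring]
  omega

/-- A window consists of two groups. With `p`, `q` the powers of `N` for each, `p * q ≤ (p ^ 2 + q ^
2) / 2`, and both squares are bounded linearly in `k`. -/
theorem card_pow_windowLength_le {N : ℕ} (hN : 0 < N) {K : ℕ} (hK : 1 ≤ K) {T : ℝ} (hT : 0 ≤ T)
    (hlam : ∀ k, K ≤ k →
      (blockGroupLength N b k : ℝ) * (6 * Real.log N) ≤ Real.log ((k : ℝ) + T))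
    {k : ℕ} (hk : K ≤ k) : (N : ℝ) ^ windowLength N b k ≤ 2 * k + 2 + T := by
  have hN1 : (1 : ℝ) ≤ N := by exact_mod_cast hN
  have hpow : ∀ j, K ≤ j → ((N : ℝ) ^ blockGroupLength N b j) ^ 2 ≤ (j : ℝ) + T := by
    intro j hj
    have hj0 : (0 : ℝ) < j := by exact_mod_cast (by omega : 0 < j)
    have h6 : ((N : ℝ) ^ blockGroupLength N b j) ^ 6 ≤ (j : ℝ) + T := by
      rw [← Real.log_le_log_iff (by positivity) (by positivity), Real.log_pow, Real.log_pow]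
      refine le_trans (le_of_eq ?_) (hlam j hj)
      push_cast
      ring
    exact (pow_le_pow_right₀ (one_le_pow₀ hN1) (by norm_num)).trans h6
  have h1 := hpow (2 * k + 1) (by omega)
  have h2 := hpow (2 * k + 2) (by omega)
  rw [windowLength_eq, pow_add]
  push_cast at h1 h2
  nlinarith [sq_nonneg ((N : ℝ) ^ blockGroupLength N b (2 * k + 1) -
    (N : ℝ) ^ blockGroupLength N b (2 * k + 2))]

theorem not_summable_mixingRate [Nonempty V] {K : ℕ} (hK : 1 ≤ K) {T : ℝ} (hT : 0 ≤ T)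
    (hlam : ∀ k, K ≤ k →
      (blockGroupLength (Fintype.card V) b k : ℝ) * (6 * Real.log (Fintype.card V)) ≤
        Real.log ((k : ℝ) + T)) :
    ¬ Summable fun k => mixingRate V (windowLength (Fintype.card V) b k) := by
  intro hsum
  have hcard : (0 : ℝ) < Fintype.card V := by exact_mod_cast Fintype.card_pos
  set C : ℝ := (Fintype.card V : ℝ) + (Fintype.card V : ℝ) ^ 2 with hC
  have hC0 : 0 < C := by positivity
  -- Comparison with the harmonic series, from index `K` on.
  refine Real.not_summable_one_div_natCast ?_
  rw [← summable_nat_add_iff K]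
  have hmul := ((summable_nat_add_iff K).2 hsum).mul_left (C * (4 + T))
  refine Summable.of_nonneg_of_le (fun k => by positivity) (fun k => ?_) hmul
  have hle := card_pow_windowLength_le (b := b) Fintype.card_pos hK hT hlam (Nat.le_add_left K k)
  have hk1 : (1 : ℝ) ≤ ((k + K : ℕ) : ℝ) := by exact_mod_cast (by omega : 1 ≤ k + K)
  set r : ℝ := ((k + K : ℕ) : ℝ)
  have hpos : (0 : ℝ) < (Fintype.card V : ℝ) ^ windowLength (Fintype.card V) b (k + K) := by
    positivity
  have hbound : (Fintype.card V : ℝ) ^ windowLength (Fintype.card V) b (k + K) ≤ (4 + T) * r := by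
    nlinarith
  unfold mixingRate
  rw [← hC, mul_inv, mul_mul_mul_comm, mul_inv_cancel₀ hC0.ne', one_mul,
    ← div_eq_mul_inv, div_le_div_iff₀ (by linarith) hpos]
  linarith

theorem tendsto_prod_one_sub_of_not_summable {δ : ℕ → ℝ} (h0 : ∀ k, 0 ≤ δ k) (h1 : ∀ k, δ k ≤ 1)
    (h : ¬ Summable δ) :
    Tendsto (fun k => ∏ l ∈ Finset.range k, (1 - δ l)) atTop (𝓝 0) := by
  have hsum := (not_summable_iff_tendsto_nat_atTop_of_nonneg h0).1 h
  refine squeeze_zero (fun k => Finset.prod_nonneg fun l _ => sub_nonneg.2 (h1 l)) (fun k => ?_)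
    (Real.tendsto_exp_neg_atTop_nhds_zero.comp hsum)
  rw [Function.comp_apply, ← Finset.sum_neg_distrib, Real.exp_sum]
  exact Finset.prod_le_prod (fun l _ => sub_nonneg.2 (h1 l)) fun l _ =>
    Real.one_sub_le_exp_neg (δ l)

/-- The shifted initial values have average `e * p`, with `p` the product so far; subtracting the
fraction `δ` of it replaces `p` by `p * (1 - δ)`. -/
theorem nonneg_run_window [Nonempty V] (hG : StronglyConnected G) (hloop : ∀ i, ¬ G.Adj i i)
    (hHG : ∀ k i j, (H k).Adj i j → G.Adj i j) (hHA : ∀ k i j, (H k).Adj i j → i ∈ A k)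
    (hblock : ∀ k i j, G.Adj i j ↔
      ∃ t, blockStart b k ≤ t ∧ t < blockStart b (k + 1) ∧ (H t).Adj i j)
    {x : V → ℝ} {e : ℝ} (he : 0 ≤ e) (hx : ∀ i, (∑ j, x j) / Fintype.card V - e ≤ x i) (k : ℕ) :
    (pushSumRun G A H (fun i => x i - ((∑ j, x j) / Fintype.card V -
      e * ∏ l ∈ Finset.range k, (1 - mixingRate V (windowLength (Fintype.card V) b l))))
      (blockStart b (2 * Fintype.card V * k))).Nonneg G := by
  have hcard : (0 : ℝ) < Fintype.card V := by exact_mod_cast Fintype.card_pos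
  have hcard' : 0 < Fintype.card V := Fintype.card_pos
  induction k with
  | zero =>
    refine MassState.Nonneg.run_mono hloop hHG (Nat.zero_le _) (nonneg_init fun i => ?_)
    simpa using hx i
  | succ k ih =>
    set p := ∏ l ∈ Finset.range k, (1 - mixingRate V (windowLength (Fintype.card V) b l)) with hp
    have hp0 : 0 ≤ p := Finset.prod_nonneg fun l _ => sub_nonneg.2 (mixingRate_le_one _)
    set a := (∑ j, x j) / Fintype.card V with ha
    have hsum : ∑ j, (x j - (a - e * p)) = Fintype.card V * (e * p) := by
      rw [Finset.sum_sub_distrib, Finset.sum_const, Finset.card_univ, nsmul_eq_mul, mul_sub, ha,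
        mul_div_cancel₀ _ hcard.ne']
      ring
    -- `|V| + 1 ≤ 2 |V|`, so the blocks needed fit into one window.
    have hle : blockStart b (2 * Fintype.card V * k + Fintype.card V + 1) ≤
        blockStart b (2 * Fintype.card V * (k + 1)) := blockStart_mono b (by
      rw [mul_add]; omega)
    have hmono : blockStart b (2 * Fintype.card V * k) ≤
        blockStart b (2 * Fintype.card V * (k + 1)) :=
      blockStart_mono b (Nat.mul_le_mul_left _ (Nat.le_succ k))
    have h := nonneg_sub_average hG hloop hHG hHA hblock
      (w := windowLength (Fintype.card V) b k) ih
      (by unfold windowLength; omega) (by rw [hsum]; positivity)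
    rw [hsum, mul_div_cancel_left₀ _ hcard.ne'] at h
    have h' := h.run_mono hloop hHG hle
    convert h' using 3 with i
    rw [Finset.prod_range_succ]
    ring

/-- The asymptotic lower bound on the ratios; applied to `-x` it gives the upper bound. -/
theorem eventually_lt_ratio (hG : StronglyConnected G) (hloop : ∀ i, ¬ G.Adj i i)
    (hHG : ∀ k i j, (H k).Adj i j → G.Adj i j) (hHA : ∀ k i j, (H k).Adj i j → i ∈ A k)
    (hblock : ∀ k i j, G.Adj i j ↔
      ∃ t, blockStart b k ≤ t ∧ t < blockStart b (k + 1) ∧ (H t).Adj i j)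
    {K : ℕ} (hK : 1 ≤ K) {T : ℝ} (hT : 0 ≤ T)
    (hlam : ∀ k, K ≤ k →
      (blockGroupLength (Fintype.card V) b k : ℝ) * (6 * Real.log (Fintype.card V)) ≤
        Real.log ((k : ℝ) + T))
    (x : V → ℝ) (i : V) {c : ℝ} (hc : c < (∑ j, x j) / Fintype.card V) :
    ∀ᶠ t in atTop, c < xMass G A H x t i / yMass G A H t i := by
  have : Nonempty V := ⟨i⟩
  set a := (∑ j, x j) / Fintype.card V with ha
  obtain ⟨e, he, hx⟩ : ∃ e, 0 ≤ e ∧ ∀ i, a - e ≤ x i := by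
    refine ⟨∑ i, |a - x i|, Finset.sum_nonneg fun _ _ => abs_nonneg _, fun i => ?_⟩
    have h1 := Finset.single_le_sum (f := fun i => |a - x i|) (fun _ _ => abs_nonneg _)
      (Finset.mem_univ i)
    have h2 := le_abs_self (a - x i)
    linarith
  have hlim := (tendsto_prod_one_sub_of_not_summable (fun k => mixingRate_nonneg _)
    (fun k => mixingRate_le_one _) (not_summable_mixingRate (V := V) hK hT hlam)).const_mul e
  rw [mul_zero] at hlim
  obtain ⟨k, hk⟩ := (hlim.eventually_lt_const (sub_pos.2 hc)).exists
  filter_upwards [eventually_ge_atTop (blockStart b (2 * Fintype.card V * k))] with t ht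
  -- By linearity, nonnegativity of the shifted run says `q * y_i ≤ x_i`.
  have hval := ((nonneg_run_window hG hloop hHG hHA hblock he hx k).run_mono hloop hHG ht).1 i
  set q := a - e * ∏ l ∈ Finset.range k, (1 - mixingRate V (windowLength (Fintype.card V) b l))
    with hq
  have hlin := (pushSumRun_add_mul (G := G) (A := A) (H := H) x (fun _ => 1) (-q) t).1 i
  simp only [mul_one, ← sub_eq_add_neg] at hlin
  rw [hlin, neg_mul, ← sub_eq_add_neg, sub_nonneg] at hval
  refine lt_of_lt_of_le (by linarith : c < q) ?_
  rw [le_div_iff₀ (yMass_pos hloop hHG t i)]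
  exact hval

theorem xMass_neg (x : V → ℝ) (t : ℕ) (i : V) :
    xMass G A H (fun j => -x j) t i = -xMass G A H x t i := by
  -- Negation as `x + (-2) * x`, an instance of linearity.
  have h := (pushSumRun_add_mul (G := G) (A := A) (H := H) x x (-2) t).1 i
  have hx : (fun i => x i + -2 * x i) = fun i => -x i := by ext; ring
  rw [hx] at h
  unfold xMass
  rw [h]
  ring

end Convergence

theorem theorem1 (n : ℕ)
    (G : Digraph (Fin n)) (hG : StronglyConnected G) (hloop : ∀ i, ¬ G.Adj i i)
    -- `A k`: the nodes that wake up at iteration `k`; any subset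
    (A : ℕ → Set (Fin n))
    -- `H k`: the links of `G` that transmit successfully at iteration `k`
    (H : ℕ → Digraph (Fin n))
    (hHG : ∀ k i j, (H k).Adj i j → G.Adj i j)
    (hHA : ∀ k i j, (H k).Adj i j → i ∈ A k)
    -- the block lengths `b 1, b 2, …`
    (b : ℕ → ℕ) (hb : ∀ k, 1 ≤ k → 0 < b k)
    (hblock : ∀ k i j, G.Adj i j ↔
      ∃ t, blockStart b k ≤ t ∧ t < blockStart b (k + 1) ∧ (H t).Adj i j)
    -- `λ_k ≤ ln (k + T) / (6 ln n)`, multiplied out so that `n = 1` is covered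
    (K : ℕ) (hK : 1 ≤ K) (T : ℝ) (hT : 0 ≤ T)
    (hlam : ∀ k, K ≤ k →
      (blockGroupLength n b k : ℝ) * (6 * Real.log n) ≤ Real.log ((k : ℝ) + T))
    (x0 : Fin n → ℝ) (i : Fin n) :
    (∀ k, 0 < yMass G A H k i) ∧
      Tendsto (fun k => xMass G A H x0 k i / yMass G A H k i) atTop
        (𝓝 ((∑ j, x0 j) / n)) := by
  have hpos : ∀ k, 0 < yMass G A H k i := fun k => yMass_pos hloop hHG k i
  have hlam' : ∀ k, K ≤ k → (blockGroupLength (Fintype.card (Fin n)) b k : ℝ) *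
      (6 * Real.log (Fintype.card (Fin n))) ≤ Real.log ((k : ℝ) + T) := by
    simpa only [Fintype.card_fin] using hlam
  refine ⟨hpos, tendsto_order.2 ⟨fun c hc => ?_, fun c hc => ?_⟩⟩
  · exact eventually_lt_ratio hG hloop hHG hHA hblock hK hT hlam' x0 i
      (by rwa [Fintype.card_fin])
  · have h := eventually_lt_ratio hG hloop hHG hHA hblock hK hT hlam' (fun j => -x0 j) i
      (c := -c) (by rw [Fintype.card_fin, Finset.sum_neg_distrib, neg_div]; linarith)
    filter_upwards [h] with t ht
    rw [xMass_neg, neg_div] at ht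
    linarith
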